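/- Let $\mathbb F_q$ be a finite field with $q$ elements, let $K_\infty=\mathbb F_q((1/\theta))$ with $|\theta|=q$, and let $\mathbb C_\infty$ be the completion of an algebraic closure of $K_\infty$. Let $n\ge 1$, and let $C^{\otimes n}$ be the $n$-th tensor power of the Carlitz module, that is, the $\mathbb F_q$-algebra homomorphism $a\mapsto C^{\otimes n}_a$ from $\mathbb F_q[t]$ to $\mathrm{Mat}_n(\mathbb C_\infty)[\tau]$ (where $\tau$ is the $q$-power Frobenius) with $$C^{\otimes n}_t=\begin{pmatrix}\theta&1&&\\&\theta&\ddots&\\&&\ddots&1\\&&&\theta\end{pmatrix}+\begin{pmatrix}0&\cdots&0\\\vdots&&\vdots\\1&\cdots&0\end{pmatrix}\tau ;$$ for $n=1$ this is $\theta+\tau$. Let $\mathrm{Exp}_{C^{\otimes n}}=\sum_{i\ge 0}Q_i\tau^i$ be the unique twisted power series with $Q_0=I$ and $\mathrm{Exp}_{C^{\otimes n}}\circ d[a]=C^{\otimes n}_a\circ \mathrm{Exp}_{C^{\otimes n}}$ for all $a\in\mathbb F_q[t]$, where $d[a]$ is the constant term of $C^{\otimes n}_a$, and let $\mathrm{Log}_{C^{\otimes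 n}}=\sum_{i\ge 0}P_i\tau^i$ be its inverse. For $\mathbf z=(z_1,\dots,z_n)^\top\in\mathbb C_\infty^n$ write $\mathbf z^{(i)}=(z_1^{q^i},\dots,z_n^{q^i})^\top$; the domain of convergence of the logarithm is the set of $\mathbf z$ for which $\mathrm{Log}_{C^{\otimes n}}(\mathbf z)=\sum_{i\ge 0}P_i\mathbf z^{(i)}$ converges. Let $M=\mathbb C_\infty[t]$ with $\tau(m)=(t-\theta)^n m^{(1)}$, where $m^{(1)}$ is obtained from $m$ by raising the coefficients to the $q$-th power, and let $g_k=(t-\theta)^{k-1}$ for $1\le k\le n$, a $\mathbb C_\infty[\tau]$-basis of $M$. For $\mathbf z\in\mathbb C_\infty^n$ define $\delta^M_{1,\mathbf z}$ on $M$ by $\delta^M_{1,\mathbf z}\big(\sum_{i,k}c_{i,k}\tau^i(g_k)\big)=\sum_{i,k}c_{i,k}z_k^{q^i}$, and extend it to power series $f\in\mathbb C_\infty[[t]]$ as follows: if $f=\sum_{i\ge0}\sum_{k=1}^n c_{i,k}\tau^i(g_k)$, where the partial sums over $i$ converge to $f$ in each of the norms $\|\sum_j b_jt^j\|_r=\sup_j|b_j|r^j$,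 $r>0$, and if $\sum_{i\ge0}\big(\sum_{k=1}^n c_{i,k}z_k^{q^i}\big)$ converges, then $\delta^M_{1,\mathbf z}(f)$ is defined and is the sum of the latter series. Fix $\lambda=(-\theta)^{1/(q-1)}\in\mathbb C_\infty$ with $\lambda^{q-1}=-\theta$, and put $$\tilde\pi=\lambda^q\prod_{i\ge1}\big(1-\theta^{1-q^i}\big)^{-1}\in\mathbb C_\infty,\qquad \omega_C=\lambda\prod_{i\ge0}\Big(1-\frac{t}{\theta^{q^i}}\Big)^{-1}\in\mathbb C_\infty[[t]].$$ Theorem. Let $\mathbf z\in\mathbb C_\infty^n$ be in the domain of convergence of $\mathrm{Log}_{C^{\otimes n}}$, and let $p_n$ denote the projection onto the $n$-th coordinate. Then $\delta^M_{1,\mathbf z}$ is defined, with a unique value, at $\tilde\pi^n/\big((t-\theta)\omega_C^n\big)$, and $$p_n\big(\mathrm{Log}_{C^{\otimes n}}(\mathbf z)\big)=\delta^M_{1,\mathbf z}\left(\frac{\tilde\pi^n}{(t-\theta)\,\omega_C^n}\right).$$ -/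

import Mathlib

open scoped NNReal WithZero

namespace CarlitzTensor
noncomputable section

section CInfty
variable (F : Type*) [Field F]

open scoped Classical in
/-- `K_∞ = F((1/θ))`, the completion of `F(θ)` at the place at infinity. -/
abbrev KInfty : Type _ := RatFunc.CompletionAtInfty F

lemma KInfty.v_X : Valued.v (algebraMap (RatFunc F) (KInfty F) RatFunc.X) = WithZero.exp (1:ℤ) := by
  classical
  let := RatFunc.inftyValued F
  rw [RatFunc.valuedCompletionAtInfty.def]
  erw [Valued.extensionValuation_apply_coe]
  exact RatFunc.inftyValuation.X F

variable [Fintype F]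

/-- The norm on `K_∞` is normalised by `|θ| = q`, where `q` is the cardinality of `F`. -/
instance KInfty.rankOne :
    Valuation.RankOne (Valued.v : Valuation (KInfty F) ℤᵐ⁰) where
  hom' := (WithZeroMulInt.toNNReal (e := (Fintype.card F : ℝ≥0))
    (by exact_mod_cast Fintype.card_ne_zero)).comp MonoidWithZeroHom.ValueGroup₀.embedding
  strictMono' := (WithZeroMulInt.toNNReal_strictMono
    (by exact_mod_cast Fintype.one_lt_card)).comp MonoidWithZeroHom.ValueGroup₀.embedding_strictMono
  exists_val_nontrivial :=
    ⟨algebraMap (RatFunc F) (KInfty F) RatFunc.X, by rw [KInfty.v_X]; simp⟩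

instance : NontriviallyNormedField (KInfty F) := Valued.toNontriviallyNormedField (KInfty F) ℤᵐ⁰

instance : CompleteSpace (KInfty F) := by
  classical
  let := (RatFunc.inftyValued F).toUniformSpace
  have h : CompleteSpace (UniformSpace.Completion (RatFunc F)) := inferInstance
  exact @h

lemma KInfty.norm_X :
    ‖algebraMap (RatFunc F) (KInfty F) RatFunc.X‖ = Fintype.card F := by
  rw [Valued.toNormedField.norm_def]
  change ((WithZeroMulInt.toNNReal (e := (Fintype.card F : ℝ≥0))
    (by exact_mod_cast Fintype.card_ne_zero) (MonoidWithZeroHom.ValueGroup₀.embedding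
      (Valued.v.restrict _)) : ℝ≥0) : ℝ) = _
  rw [Valuation.embedding_restrict, KInfty.v_X,
    WithZeroMulInt.toNNReal_neg_apply _ WithZero.exp_ne_zero]
  simp [WithZero.exp]

/-- An algebraic closure of `K_∞`, with the unique extension of the absolute value. -/
abbrev KInftyBar : Type _ := AlgebraicClosure (KInfty F)

instance : NormedField (KInftyBar F) := spectralNorm.normedField (KInfty F) (KInftyBar F)
instance : NormedAlgebra (KInfty F) (KInftyBar F) := spectralNorm.normedAlgebra _ _
instance : IsUltrametricDist (KInftyBar F) :=
  IsUltrametricDist.isUltrametricDist_of_forall_norm_add_le_max_norm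
    (isNonarchimedean_spectralNorm (K := KInfty F) (L := KInftyBar F))

/-- `ℂ_∞`, the completion of an algebraic closure of `K_∞`. -/
abbrev CInfty : Type _ := UniformSpace.Completion (KInftyBar F)

/-- The embedding `F(θ) → ℂ_∞`. -/
def CInfty.ofRatFunc : RatFunc F →+* CInfty F :=
  (UniformSpace.Completion.coeRingHom.comp (algebraMap (KInfty F) (KInftyBar F))).comp
    (algebraMap (RatFunc F) (KInfty F))

instance : Algebra F (CInfty F) :=
  ((CInfty.ofRatFunc F).comp RatFunc.C).toAlgebra

/-- The element `θ ∈ ℂ_∞`, the image of the variable of `F(θ)`. -/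
def CInfty.theta : CInfty F := CInfty.ofRatFunc F RatFunc.X

lemma CInfty.norm_theta : ‖CInfty.theta F‖ = Fintype.card F := by
  rw [← KInfty.norm_X F]
  change ‖((algebraMap (KInfty F) (KInftyBar F) _ : KInftyBar F) : CInfty F)‖ = _
  rw [UniformSpace.Completion.norm_coe, norm_algebraMap']

instance : IsUltrametricDist (CInfty F) := IsUltrametricDist.of_normedAlgebra (KInftyBar F)
end CInfty

section Twisted
open Finset

/-- The ring `R⟦τ⟧` of twisted power series `∑ a_i τ^i`, with `τ a = φ(a) τ`, given by the sequence
of coefficients. The twisted polynomials `R[τ]` are its elements of finite support. -/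
def TwistedSeries {R : Type*} [Ring R] (_φ : R →+* R) : Type _ := ℕ → R

namespace TwistedSeries
variable {R : Type*} [Ring R] {φ : R →+* R}

instance : AddCommGroup (TwistedSeries φ) := inferInstanceAs (AddCommGroup (ℕ → R))

instance : Mul (TwistedSeries φ) :=
  ⟨fun f g k => ∑ p ∈ antidiagonal k, f p.1 * (φ ^ p.1) (g p.2)⟩

instance : One (TwistedSeries φ) := ⟨fun k => if k = 0 then 1 else 0⟩

@[ext] lemma ext {f g : TwistedSeries φ} (h : ∀ k, f k = g k) : f = g := funext h

lemma add_apply (f g : TwistedSeries φ) (k : ℕ) : (f + g) k = f k + g k := rfl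
lemma zero_apply (k : ℕ) : (0 : TwistedSeries φ) k = 0 := rfl
lemma one_apply (k : ℕ) : (1 : TwistedSeries φ) k = if k = 0 then 1 else 0 := rfl
lemma mul_apply (f g : TwistedSeries φ) (k : ℕ) :
    (f * g) k = ∑ p ∈ antidiagonal k, f p.1 * (φ ^ p.1) (g p.2) := rfl

instance : Ring (TwistedSeries φ) where
  __ := (inferInstance : AddCommGroup (TwistedSeries φ))
  left_distrib f g h := by
    ext k; simp [mul_apply, add_apply, mul_add, sum_add_distrib]
  right_distrib f g h := by
    ext k; simp [mul_apply, add_apply, add_mul, sum_add_distrib]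
  zero_mul f := by ext k; simp [mul_apply, zero_apply]
  mul_zero f := by ext k; simp [mul_apply, zero_apply]
  one_mul f := by
    ext k
    rw [mul_apply, sum_eq_single (0, k)]
    · simp [one_apply]
    · rintro ⟨i, j⟩ h hne
      have : i ≠ 0 := by rintro rfl; simp_all
      simp [one_apply, this]
    · simp
  mul_one f := by
    ext k
    rw [mul_apply, sum_eq_single (k, 0)]
    · simp [one_apply]
    · rintro ⟨i, j⟩ h hne
      have : j ≠ 0 := by rintro rfl; simp_all
      simp [one_apply, this]
    · simp
  mul_assoc f g h := by
    ext k
    simp only [mul_apply, sum_mul, mul_sum, map_sum, sum_sigma', map_mul]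
    refine sum_nbij' (fun x => ⟨(x.2.1, x.2.2 + x.1.2), (x.2.2, x.1.2)⟩)
      (fun x => ⟨(x.1.1 + x.2.1, x.2.2), (x.1.1, x.2.1)⟩) ?_ ?_ ?_ ?_ ?_
    · rintro ⟨⟨a, b⟩, ⟨c, d⟩⟩ hx; simp at hx ⊢; omega
    · rintro ⟨⟨a, b⟩, ⟨c, d⟩⟩ hx; simp at hx ⊢; omega
    · rintro ⟨⟨a, b⟩, ⟨c, d⟩⟩ hx; simp at hx ⊢; omega
    · rintro ⟨⟨a, b⟩, ⟨c, d⟩⟩ hx; simp at hx ⊢; omega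
    · rintro ⟨⟨a, b⟩, ⟨c, d⟩⟩ hx
      simp at hx
      obtain ⟨-, rfl⟩ := hx
      simp [pow_add, mul_assoc]

/-- The element `r τ^i`. -/
def monomial (φ : R →+* R) (i : ℕ) (r : R) : TwistedSeries φ := Pi.single i r

/-- The embedding of the coefficient ring. -/
def const (φ : R →+* R) : R →+* TwistedSeries φ where
  toFun := monomial φ 0
  map_one' := by ext k; rcases k with _ | k <;> simp [monomial, one_apply]
  map_zero' := by simp [monomial]; rfl
  map_add' a b := by simp [monomial, Pi.single_add]; rfl
  map_mul' a b := by
    ext k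
    rw [mul_apply, sum_eq_single (0, k)]
    · rcases k with _ | k <;> simp [monomial]
    · rintro ⟨i, j⟩ h hne
      have : i ≠ 0 := by rintro rfl; simp_all
      simp [monomial, this]
    · simp

lemma const_apply (r : R) (k : ℕ) : const φ r k = if k = 0 then r else 0 := by
  change (Pi.single 0 r : ℕ → R) k = _
  by_cases h : k = 0 <;> simp [h]

lemma const_mul_apply (r : R) (f : TwistedSeries φ) (k : ℕ) : (const φ r * f) k = r * f k := by
  rw [mul_apply, sum_eq_single (0, k)]
  · simp [const_apply]
  · rintro ⟨i, j⟩ h hne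
    have : i ≠ 0 := by rintro rfl; simp_all
    simp [const_apply, this]
  · simp

lemma mul_const_apply (r : R) (f : TwistedSeries φ) (k : ℕ) :
    (f * const φ r) k = f k * (φ ^ k) r := by
  rw [mul_apply, sum_eq_single (k, 0)]
  · simp [const_apply]
  · rintro ⟨i, j⟩ h hne
    have : j ≠ 0 := by rintro rfl; simp_all
    simp [const_apply, this]
  · simp

lemma const_commute {r : R} (hr : ∀ s, Commute r s) (h : φ r = r) (f : TwistedSeries φ) :
    Commute (const φ r) f := by
  ext k
  have : (φ ^ k) r = r := by
    induction k with
    | zero => simp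
    | succ k ih => rw [pow_succ', RingHom.mul_def, RingHom.comp_apply, ih, h]
  rw [const_mul_apply, mul_const_apply, this, (hr _).eq]

/-- The constant term, as a ring homomorphism. -/
def constCoeff (φ : R →+* R) : TwistedSeries φ →+* R where
  toFun f := f 0
  map_one' := by simp [one_apply]
  map_zero' := rfl
  map_add' _ _ := rfl
  map_mul' f g := by simp [mul_apply]

lemma exists_left_inv {f : TwistedSeries φ} (hf : f 0 = 1) :
    ∃ g : TwistedSeries φ, g 0 = 1 ∧ g * f = 1 := by
  let g : TwistedSeries φ := Nat.strongRec fun k ih =>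
    (if k = 0 then 1 else 0) - ∑ i : Fin k, ih i i.2 * (φ ^ (i : ℕ)) (f (k - i))
  have hg : ∀ k, g k = (if k = 0 then 1 else 0) -
      ∑ i : Fin k, g i * (φ ^ (i : ℕ)) (f (k - i)) := by
    intro k; exact Nat.strongRec_eq ..
  refine ⟨g, by rw [hg]; simp, ?_⟩
  ext k
  rw [mul_apply, Nat.sum_antidiagonal_eq_sum_range_succ_mk, sum_range_succ, one_apply]
  simp only [Nat.sub_self, hf, map_one, mul_one]
  conv_lhs => rw [hg k]
  rw [← Fin.sum_univ_eq_sum_range (fun i => g i * (φ ^ i) (f (k - i)))]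
  abel

lemma isUnit_of_apply_zero {f : TwistedSeries φ} (hf : f 0 = 1) : IsUnit f := by
  obtain ⟨g, hg0, hg⟩ := exists_left_inv hf
  obtain ⟨h, -, hh⟩ := exists_left_inv hg0
  have : h = f := by
    calc h = h * (g * f) := by rw [hg, mul_one]
      _ = f := by rw [← mul_assoc, hh, one_mul]
  exact ⟨⟨f, g, this ▸ hh, hg⟩, rfl⟩
end TwistedSeries
end Twisted

section Generic
open Polynomial Matrix
variable (F : Type*) [Field F] [Fintype F] (C : Type*) [Field C] [Algebra F C] (n : ℕ) (θ : C)

/-- The `q`-power Frobenius of `C`, where `q` is the cardinality of `F`. -/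
abbrev frob : C →+* C := (FiniteField.frobeniusAlgHom F C : C →+* C)

/-- The ring `Mat_n(C)⟦τ⟧`, where `τ` acts on matrices by the entrywise `q`-power Frobenius. -/
abbrev MatSeries : Type _ := TwistedSeries ((frob F C).mapMatrix (m := Fin n))

variable {C}
/-- The matrix with `θ` on the diagonal and `1` on the superdiagonal. -/
def carlitzLie : Matrix (Fin n) (Fin n) C :=
  Matrix.of fun i j => if i = j then θ else if (i : ℕ) + 1 = j then 1 else 0

variable (C) in
/-- The matrix whose only nonzero entry is a `1` in the bottom left corner. -/
def carlitzCorner : Matrix (Fin n) (Fin n) C :=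
  Matrix.of fun i j => if (i : ℕ) + 1 = n ∧ (j : ℕ) = 0 then 1 else 0

/-- The `n`-th tensor power of the Carlitz module at `t`. -/
def carlitzT : MatSeries F C n :=
  TwistedSeries.monomial _ 0 (carlitzLie n θ) + TwistedSeries.monomial _ 1 (carlitzCorner C n)

variable (C) in
/-- The constants `F → Mat_n(C)⟦τ⟧`. -/
def scalar : F →+* MatSeries F C n :=
  (TwistedSeries.const _).comp (algebraMap F (Matrix (Fin n) (Fin n) C))

lemma scalar_commute (c : F) (f : MatSeries F C n) : Commute (scalar F C n c) f := by
  apply TwistedSeries.const_commute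
  · exact fun s => Algebra.commutes c s
  · ext i j
    by_cases h : i = j
    · subst h; simp [Matrix.algebraMap_matrix_apply]
    · simp [Matrix.algebraMap_matrix_apply, h]

/-- The `n`-th tensor power of the Carlitz module: the homomorphism `a ↦ φ_a` of `F`-algebras
`F[t] → Mat_n(C)[τ]` with `φ_t` as above. -/
def carlitzTensor : F[X] →+* MatSeries F C n :=
  Polynomial.eval₂RingHom' (scalar F C n) (carlitzT F n θ) fun c => scalar_commute F n c _

/-- `d[a]`, the constant term of `φ_a`. -/
def lieAction : F[X] →+* Matrix (Fin n) (Fin n) C :=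
  (TwistedSeries.constCoeff _).comp (carlitzTensor F n θ)

lemma lieAction_apply (a : F[X]) : lieAction F n θ a = carlitzTensor F n θ a 0 := rfl

/-- `Q = ∑ Q_i τ^i` is the exponential series: `Q_0 = 1` and `Q ∘ d[a] = φ_a ∘ Q` for all `a`. -/
def IsExp (Q : MatSeries F C n) : Prop :=
  Q 0 = 1 ∧ ∀ a : F[X],
    Q * TwistedSeries.const _ (lieAction F n θ a) = carlitzTensor F n θ a * Q

lemma frob_pow_apply (k : ℕ) (x : C) : (frob F C ^ k) x = x ^ Fintype.card F ^ k := by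
  induction k with
  | zero => simp
  | succ k ih =>
    rw [pow_succ', RingHom.mul_def, RingHom.comp_apply, ih]
    simp [pow_mul, pow_succ]

lemma mapMatrix_pow (k : ℕ) (A : Matrix (Fin n) (Fin n) C) :
    ((frob F C).mapMatrix ^ k) A = A.map (frob F C ^ k) := by
  induction k with
  | zero => ext; simp
  | succ k ih =>
    rw [pow_succ', RingHom.mul_def, RingHom.comp_apply, ih]
    ext i j
    simp [pow_succ', -FiniteField.frobeniusAlgHom_apply]

lemma carlitzLie_eq : carlitzLie n θ = θ • (1 : Matrix (Fin n) (Fin n) C) + carlitzLie n 0 := by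
  ext i j
  by_cases h : i = j <;> simp [carlitzLie, h]

lemma carlitzLie_map (k : ℕ) :
    ((frob F C).mapMatrix ^ k) (carlitzLie n θ) = carlitzLie n (θ ^ Fintype.card F ^ k) := by
  rw [mapMatrix_pow]
  ext i j
  simp only [carlitzLie, map_apply, of_apply]
  split_ifs <;> simp [frob_pow_apply]

lemma carlitzLie_zero_nilpotent : IsNilpotent (carlitzLie n (0 : C)) := by
  have h : (carlitzLie n (0 : C)).charpoly = X ^ n := by
    rw [Matrix.charpoly_of_isUpperTriangular]
    · simp [carlitzLie]
    · intro i j hij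
      have h1 : (j : ℕ) < i := hij
      have h2 : i ≠ j := by rintro rfl; omega
      simp [carlitzLie, h2]; omega
  refine ⟨n, ?_⟩
  have := Matrix.aeval_self_charpoly (carlitzLie n (0 : C))
  simpa [h] using this

/-- `X ↦ a X + X N - N X` is bijective for `a ≠ 0` and nilpotent `N`. -/
lemma sylvester (k : ℕ) (hk : θ ^ Fintype.card F ^ k ≠ θ) (B : Matrix (Fin n) (Fin n) C) :
    ∃! X : Matrix (Fin n) (Fin n) C,
      X * ((frob F C).mapMatrix ^ k) (carlitzLie n θ) = carlitzLie n θ * X + B := by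
  set a : C := θ ^ Fintype.card F ^ k - θ
  have ha : a ≠ 0 := sub_ne_zero.mpr hk
  set N := carlitzLie n (0 : C)
  let D : Module.End C (Matrix (Fin n) (Fin n) C) := LinearMap.mulRight C N - LinearMap.mulLeft C N
  have hD : IsNilpotent D := by
    refine Commute.isNilpotent_sub ?_ ?_ ?_
    · exact (LinearMap.commute_mulLeft_right N N).symm
    · exact (LinearMap.isNilpotent_mulRight_iff C N).mpr (carlitzLie_zero_nilpotent n)
    · exact (LinearMap.isNilpotent_mulLeft_iff C N).mpr (carlitzLie_zero_nilpotent n)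
  have hU : IsUnit (algebraMap C (Module.End C (Matrix (Fin n) (Fin n) C)) a + D) :=
    hD.isUnit_add_left_of_commute ((isUnit_iff_ne_zero.mpr ha).map _)
      (Algebra.commutes a D).symm
  have hb := (Module.End.isUnit_iff _).mp hU
  have key : ∀ X, X * ((frob F C).mapMatrix ^ k) (carlitzLie n θ) = carlitzLie n θ * X + B ↔
      (algebraMap C (Module.End C (Matrix (Fin n) (Fin n) C)) a + D) X = B := by
    intro X
    rw [carlitzLie_map, carlitzLie_eq n θ, carlitzLie_eq n (θ ^ _)]
    simp only [LinearMap.add_apply, Module.algebraMap_end_apply, D, LinearMap.sub_apply,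
      LinearMap.mulRight_apply, LinearMap.mulLeft_apply, a, N, mul_add, add_mul, sub_smul,
      mul_smul_comm, smul_mul_assoc, mul_one, one_mul]
    rw [← sub_eq_zero, ← sub_eq_zero (b := B)]
    exact ⟨fun h => by rw [← h]; abel, fun h => by rw [← h]; abel⟩
  simp_rw [key]
  exact hb.existsUnique B

lemma isExp_iff (Q : MatSeries F C n) : IsExp F n θ Q ↔ Q 0 = 1 ∧ ∀ k,
    Q (k + 1) * ((frob F C).mapMatrix ^ (k + 1)) (carlitzLie n θ) =
      carlitzLie n θ * Q (k + 1) + carlitzCorner C n * (frob F C).mapMatrix (Q k) := by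
  have hX : carlitzTensor F n θ X = carlitzT F n θ := by simp [carlitzTensor]
  have hd : lieAction F n θ X = carlitzLie n θ := by
    rw [lieAction_apply, hX, carlitzT, TwistedSeries.add_apply]; simp [TwistedSeries.monomial]
  have hm : ∀ k, (carlitzT F n θ * Q) (k + 1) =
      carlitzLie n θ * Q (k + 1) + carlitzCorner C n * (frob F C).mapMatrix (Q k) := by
    intro k
    rw [carlitzT, add_mul, TwistedSeries.add_apply]
    congr 1
    · exact TwistedSeries.const_mul_apply _ _ _
    · rw [TwistedSeries.mul_apply, Finset.sum_eq_single (1, k)]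
      · simp [TwistedSeries.monomial]
      · rintro ⟨i, j⟩ h hne
        have : i ≠ 1 := by
          rintro rfl
          simp only [Finset.HasAntidiagonal.mem_antidiagonal] at h
          exact hne (by simp; omega)
        simp [TwistedSeries.monomial, this]
      · intro h; exact absurd (by simp; omega) h
  have hm0 : (carlitzT F n θ * Q) 0 = carlitzLie n θ * Q 0 := by
    rw [TwistedSeries.mul_apply]
    rw [Finset.Nat.antidiagonal_zero, Finset.sum_singleton, carlitzT, TwistedSeries.add_apply]
    simp [TwistedSeries.monomial]
  refine and_congr_right fun h0 => ⟨fun h k => ?_, fun h => ?_⟩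
  · have := congrFun (h X) (k + 1)
    rwa [hX, hd, hm, TwistedSeries.mul_const_apply] at this
  · have hT : Q * TwistedSeries.const _ (lieAction F n θ X) = carlitzTensor F n θ X * Q := by
      rw [hX, hd]
      ext1 k
      rcases k with _ | k
      · rw [TwistedSeries.mul_const_apply, hm0, h0]; simp
      · rw [TwistedSeries.mul_const_apply, h, hm]
    have hC : ∀ c, Q * TwistedSeries.const _ (lieAction F n θ (Polynomial.C c)) =
        carlitzTensor F n θ (Polynomial.C c) * Q := by
      intro c
      have e1 : carlitzTensor F n θ (Polynomial.C c) = scalar F C n c := by simp [carlitzTensor]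
      have e2 : TwistedSeries.const _ (lieAction F n θ (Polynomial.C c)) = scalar F C n c := by
        rw [lieAction_apply, e1]
        simp [scalar, TwistedSeries.const_apply]
      rw [e1, e2, (scalar_commute F n c Q).eq]
    intro a
    induction a using Polynomial.induction_on with
    | C c => exact hC c
    | add p q hp hq => rw [map_add, map_add, map_add, mul_add, hp, hq, add_mul]
    | monomial m c ih =>
      rw [pow_succ, ← mul_assoc, map_mul _ (_ * _), map_mul _ (_ * _), map_mul,
        ← mul_assoc, ih, mul_assoc, hT, mul_assoc]

theorem existsUnique_isExp (hθ : ∀ k, θ ^ Fintype.card F ^ (k + 1) ≠ θ) :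
    ∃! Q : MatSeries F C n, IsExp F n θ Q := by
  have hs := fun k => sylvester F n θ (k + 1) (hθ k)
  choose S hS hS' using hs
  let Q : MatSeries F C n := fun k =>
    Nat.rec 1 (fun k P => S k (carlitzCorner C n * (frob F C).mapMatrix P)) k
  refine ⟨Q, (isExp_iff F n θ Q).mpr ⟨rfl, fun k => hS k _⟩, fun Q' hQ' => ?_⟩
  replace hQ' := (isExp_iff F n θ Q').mp hQ'
  ext1 k
  induction k with
  | zero => exact hQ'.1
  | succ k ih =>
    have := hS' k _ _ (hQ'.2 k)
    rw [this, ih]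

/-- The exponential series; it exists and is unique, see `existsUnique_isExp`, as soon as `θ` is not
fixed by a power of Frobenius. -/
def carlitzExp : MatSeries F C n := Classical.epsilon (IsExp F n θ)

theorem isExp_carlitzExp (hθ : ∀ k, θ ^ Fintype.card F ^ (k + 1) ≠ θ) :
    IsExp F n θ (carlitzExp F n θ) :=
  Classical.epsilon_spec (existsUnique_isExp F n θ hθ).exists

/-- The logarithm series `∑ P_i τ^i`, the inverse of the exponential series. -/
def carlitzLogSeries : MatSeries F C n := Ring.inverse (carlitzExp F n θ)

theorem carlitzLogSeries_spec (hθ : ∀ k, θ ^ Fintype.card F ^ (k + 1) ≠ θ) :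
    carlitzLogSeries F n θ * carlitzExp F n θ = 1 ∧
      carlitzExp F n θ * carlitzLogSeries F n θ = 1 := by
  have h := TwistedSeries.isUnit_of_apply_zero (isExp_carlitzExp F n θ hθ).1
  exact ⟨Ring.inverse_mul_cancel _ h, Ring.mul_inverse_cancel _ h⟩

theorem carlitzLogSeries_mul (hθ : ∀ k, θ ^ Fintype.card F ^ (k + 1) ≠ θ) (a : F[X]) :
    carlitzLogSeries F n θ * carlitzTensor F n θ a =
      TwistedSeries.const _ (lieAction F n θ a) * carlitzLogSeries F n θ := by
  obtain ⟨h1, h2⟩ := carlitzLogSeries_spec F n θ hθ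
  have h3 := (isExp_carlitzExp F n θ hθ).2 a
  calc _ = carlitzLogSeries F n θ * (carlitzTensor F n θ a * carlitzExp F n θ) *
        carlitzLogSeries F n θ := by rw [mul_assoc, mul_assoc, h2, mul_one]
    _ = _ := by rw [← h3, ← mul_assoc, h1, one_mul]
end Generic

section Analytic
open Polynomial Matrix Filter Topology
open scoped PowerSeries PowerSeries.WithPiTopology
variable (F : Type*) [Field F] [Fintype F] {C : Type*} [NormedField C] [Algebra F C] (n : ℕ) (θ : C)

/-- The `i`-th term `P_i z^{(i)}` of the logarithm at `z`. -/
def logTerm (z : Fin n → C) (i : ℕ) : Fin n → C :=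
  carlitzLogSeries F n θ i *ᵥ fun k => z k ^ Fintype.card F ^ i

/-- The domain of convergence of the logarithm. -/
def logDomain : Set (Fin n → C) := {z | Summable (logTerm F n θ z)}

/-- The logarithm of the `n`-th tensor power of the Carlitz module. -/
def carlitzLog (z : Fin n → C) : Fin n → C := ∑' i, logTerm F n θ z i

/-- The action `τ(m) = (t - θ)^n m^{(1)}` on the motive `M = C[t]`; here `m^{(1)}` raises the
coefficients of `m` to the `q`-th power. -/
def motiveTau (m : C[X]) : C[X] := (X - Polynomial.C θ) ^ n * m.map (frob F C)

/-- The `C[τ]`-basis `1, t - θ, …, (t - θ)^(n-1)` of the motive `M = C[t]`, which corresponds to the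
standard basis of `Mat_{1×n}(C[τ])`. -/
def motiveBasis (k : Fin n) : C[X] := (X - Polynomial.C θ) ^ (k : ℕ)

/-- `f = ∑_i ∑_k c_{i,k} τ^i(g_k)`, where `g_k` is the basis above: the partial sums converge to the
power series `f` in the topology of entire functions of `t`, that is, for each of the Gauss norms
`sup_j |b_j| r^j`, `r > 0`. -/
def IsTauExpansion (f : C⟦X⟧) (c : ℕ → Fin n → C) : Prop :=
  ∀ r : ℝ, 0 < r → ∀ ε : ℝ, 0 < ε → ∀ᶠ m in atTop, ∀ j : ℕ,
    ‖PowerSeries.coeff j (f - ((∑ i ∈ Finset.range m, ∑ k : Fin n,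
      Polynomial.C (c i k) * (motiveTau F n θ)^[i] (motiveBasis n θ k) : C[X]) : C⟦X⟧))‖ * r ^ j ≤ ε

/-- The map `δ_{1,z}` on `M = Mat_{1×n}(C[τ])` is evaluation at `z`, so that `c τ^i(g_k) ↦ c z_k^(q^i)`.
It is extended to infinite expansions by taking the limit over partial sums:
`HasDeltaOne F n θ z f v` says that `f` has an expansion `∑_i ∑_k c_{i,k} τ^i(g_k)` such that
`∑_i (∑_k c_{i,k} z_k^(q^i))` converges to `v`. -/
def HasDeltaOne (z : Fin n → C) (f : C⟦X⟧) (v : C) : Prop :=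
  ∃ c : ℕ → Fin n → C, IsTauExpansion F n θ f c ∧
    HasSum (fun i => ∑ k : Fin n, c i k * z k ^ Fintype.card F ^ i) v

/-- The period `(-θ)^(q/(q-1)) ∏_{i ≥ 1} (1 - θ^(1-q^i))⁻¹`, where `lam` is the chosen `(q-1)`-st root
of `-θ`. -/
def carlitzPeriod (lam : C) : C :=
  lam ^ Fintype.card F * ∏' i : ℕ, (1 - θ ^ (1 - (Fintype.card F : ℤ) ^ (i + 1)))⁻¹

/-- The Anderson–Thakur function `(-θ)^(1/(q-1)) ∏_{i ≥ 0} (1 - t/θ^(q^i))⁻¹` as a power series in `t`,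
where `lam` is the chosen `(q-1)`-st root of `-θ`. -/
def andersonThakur (lam : C) : C⟦X⟧ :=
  PowerSeries.C lam *
    ∏' i : ℕ, (1 - PowerSeries.C (θ ^ Fintype.card F ^ i)⁻¹ * PowerSeries.X)⁻¹

end Analytic

section Convergence
open scoped PowerSeries PowerSeries.WithPiTopology
variable (F : Type*) [Field F] [Fintype F] {C : Type*} [NormedField C] {θ : C}

/-- The exponential and logarithm series of the tensor powers exist if `|θ| > 1`. -/
lemma pow_ne_of_one_lt_norm (hθ : 1 < ‖θ‖) (k : ℕ) : θ ^ Fintype.card F ^ (k + 1) ≠ θ := by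
  intro h
  have h1 := congrArg norm h
  rw [norm_pow] at h1
  exact (lt_self_pow₀ hθ (Nat.one_lt_pow (by omega) Fintype.one_lt_card)).ne' h1

lemma CInfty.one_lt_norm_theta : 1 < ‖CInfty.theta F‖ := by
  rw [CInfty.norm_theta]
  exact_mod_cast Fintype.one_lt_card

lemma summable_inv (hθ : 1 < ‖θ‖) : Summable fun i : ℕ => ‖(θ ^ Fintype.card F ^ i)⁻¹‖ := by
  refine Summable.of_nonneg_of_le (fun _ => norm_nonneg _) (fun i => ?_)
    (summable_geometric_of_lt_one (inv_nonneg.mpr (norm_nonneg θ)) (inv_lt_one_of_one_lt₀ hθ))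
  rw [norm_inv, norm_pow, inv_pow]
  gcongr
  · exact hθ.le
  · exact (Nat.lt_pow_self Fintype.one_lt_card).le

variable [IsUltrametricDist C] [CompleteSpace C]

/-- The product in the definition of the period converges. -/
lemma multipliable_carlitzPeriod (hθ : 1 < ‖θ‖) :
    Multipliable fun i : ℕ => (1 - θ ^ (1 - (Fintype.card F : ℤ) ^ (i + 1)))⁻¹ := by
  set v : ℕ → C := fun i => θ ^ (1 - (Fintype.card F : ℤ) ^ (i + 1))
  have h0 : θ ≠ 0 := by rintro rfl; simp at hθ; linarith
  have hv : ∀ i, ‖v i‖ = ‖θ‖ * ‖(θ ^ Fintype.card F ^ (i + 1))⁻¹‖ := by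
    intro i
    simp only [v]
    rw [zpow_sub₀ h0, zpow_one, div_eq_mul_inv, norm_mul]
    norm_cast
  have hlt : ∀ i, ‖v i‖ < 1 := by
    intro i
    rw [hv, norm_inv, norm_pow, ← div_eq_mul_inv, div_lt_one (by positivity)]
    exact lt_self_pow₀ hθ (Nat.one_lt_pow (by omega) Fintype.one_lt_card)
  have hn : ∀ i, ‖1 - v i‖ = 1 := by
    intro i
    rw [sub_eq_add_neg, IsUltrametricDist.norm_add_eq_max_of_norm_ne_norm
      (by rw [norm_one, norm_neg]; exact (hlt i).ne'), norm_one, norm_neg, max_eq_left (hlt i).le]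
  have hs : Summable fun i => ‖v i / (1 - v i)‖ := by
    simp_rw [norm_div, hn, div_one, hv]
    exact ((summable_nat_add_iff 1).mpr (summable_inv F hθ)).mul_left _
  refine (multipliable_one_add_of_summable hs).congr fun i => ?_
  have : 1 - v i ≠ 0 := by rw [← norm_ne_zero_iff, hn]; simp
  change 1 + v i / (1 - v i) = (1 - v i)⁻¹
  field_simp
  ring

lemma multipliable_inv_one_sub {u : ℕ → C} (hu1 : ∀ i, ‖u i‖ ≤ 1) (hu : Summable fun i => ‖u i‖) :
    Multipliable fun i : ℕ => (1 - PowerSeries.C (u i) * PowerSeries.X : C⟦X⟧)⁻¹ := by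
  let f : ℕ → C⟦X⟧ := fun i => PowerSeries.mk fun k => if k = 0 then 0 else u i ^ k
  have hf : ∀ i, (1 - PowerSeries.C (u i) * PowerSeries.X : C⟦X⟧)⁻¹ = 1 + f i := by
    intro i
    symm
    rw [PowerSeries.eq_inv_iff_mul_eq_one (by simp)]
    have : (1 : C⟦X⟧) + f i = PowerSeries.mk fun k => u i ^ k := by
      ext k
      rcases k with _ | k <;> simp [f, PowerSeries.coeff_one]
    rw [this, mul_sub, mul_one, ← mul_assoc, mul_comm _ (PowerSeries.C _), mul_assoc]
    ext k
    rcases k with _ | k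
    · simp
    · simp [PowerSeries.coeff_succ_mul_X, PowerSeries.coeff_one, pow_succ']
  rw [funext hf]
  apply multipliable_one_add_of_summable_prod
  rw [PowerSeries.WithPiTopology.summable_iff_summable_coeff]
  intro d
  have hmul : ∀ (a b : C⟦X⟧) (x y : ℝ), 0 ≤ x → (∀ j, ‖PowerSeries.coeff j a‖ ≤ x) →
      (∀ j, ‖PowerSeries.coeff j b‖ ≤ y) → ∀ j, ‖PowerSeries.coeff j (a * b)‖ ≤ x * y := by
    intro a b x y hx ha hb j
    rw [PowerSeries.coeff_mul]
    refine IsUltrametricDist.norm_sum_le_of_forall_le_of_nonneg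
      (mul_nonneg hx ((norm_nonneg _).trans (hb 0))) fun p _ => ?_
    rw [norm_mul]
    exact mul_le_mul (ha _) (hb _) (norm_nonneg _) hx
  have hbd : ∀ (s : Finset ℕ) (j : ℕ),
      ‖PowerSeries.coeff j (∏ i ∈ s, f i)‖ ≤ ∏ i ∈ s, ‖u i‖ := by
    intro s
    induction s using Finset.induction_on with
    | empty =>
      intro j
      simp only [Finset.prod_empty, PowerSeries.coeff_one]
      split_ifs <;> simp
    | insert a s ha ih =>
      rw [Finset.prod_insert ha, Finset.prod_insert ha]
      refine hmul _ _ _ _ (norm_nonneg _) (fun j => ?_) ih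
      simp only [f, PowerSeries.coeff_mk]
      split_ifs with h
      · simp
      · rw [norm_pow]
        exact pow_le_of_le_one (norm_nonneg _) (hu1 a) h
  exact Summable.of_norm_bounded
    (summable_finsetProd_of_summable_nonneg (fun _ => norm_nonneg _) hu)
    fun s => hbd s d

/-- The product in the definition of the Anderson–Thakur function converges. -/
lemma multipliable_andersonThakur (hθ : 1 < ‖θ‖) :
    Multipliable fun i : ℕ =>
      (1 - PowerSeries.C (θ ^ Fintype.card F ^ i)⁻¹ * PowerSeries.X : C⟦X⟧)⁻¹ := by
  refine multipliable_inv_one_sub (fun i => ?_) (summable_inv F hθ)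
  rw [norm_inv, norm_pow]
  exact inv_le_one_of_one_le₀ (one_le_pow₀ hθ.le)
end Convergence
end
end CarlitzTensor

/-! Write `p_n(Log(z)) = ∑_i ∑_k c_{i,k} z_k^(q^i)`, where `c_i` is the last row of `P_i`. It
suffices that these `c_{i,k}` are the coefficients of a `τ`-expansion of `π^n/((t-θ)ω^n)`, and that
such an expansion is unique. Existence: comparing coefficients in `Log ∘ C_t = d[t] ∘ Log` gives a
recursion that closes on the last rows, because the last row of `d[t]` is `(0,…,0,θ)`. Its solution
is geometric in `k` (`carlitzLogSeries_last_row`), so the partial sums telescope to `(t-θ)^(n-1)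
∏_{1≤j≤m} ((t-θ^(q^j))/(θ-θ^(q^j)))^n` (`sum_carlitzLogSeries_last_row`). The products without the
exponent converge in every Gauss norm to `π/((t-θ)ω)` (`exists_gaussTendsto_partialProduct`).
Uniqueness: a `τ`-expansion is a Newton interpolation series at the nodes `θ^(q^i)`, each repeated
`n` times. Its coefficients are controlled by Gauss norms (`norm_newton_coeff_le`), so two
expansions of the same function agree (`IsTauExpansion.unique`). -/

namespace CarlitzTensor
noncomputable section

/-! ### Gauss norms and coefficients of Newton expansions -/

section GaussBound
open Polynomial Filter Topology
open scoped PowerSeries PowerSeries.WithPiTopology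
variable {C : Type*} [NormedField C] {r A B : ℝ} {f g : C⟦X⟧}

/-- The Gauss norm `sup_j |b_j| r^j` of the power series `∑ b_j t^j` is at most `B`. -/
def GaussBound (r B : ℝ) (f : C⟦X⟧) : Prop := ∀ j, ‖PowerSeries.coeff j f‖ * r ^ j ≤ B

lemma GaussBound.mono (hf : GaussBound r A f) (h : A ≤ B) : GaussBound r B f :=
  fun j => (hf j).trans h

lemma GaussBound.nonneg (hf : GaussBound r B f) : 0 ≤ B := by
  have := hf 0
  rw [pow_zero, mul_one] at this
  exact (norm_nonneg _).trans this

lemma GaussBound.neg (hf : GaussBound r B f) : GaussBound r B (-f) := by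
  intro j
  rw [map_neg, norm_neg]
  exact hf j

lemma gaussBound_C (a : C) : GaussBound r ‖a‖ (PowerSeries.C a) := by
  intro j
  rw [PowerSeries.coeff_C]
  split_ifs with h
  · simp [h]
  · simp

lemma gaussBound_X (hr : 0 ≤ r) : GaussBound r r (PowerSeries.X : C⟦X⟧) := by
  intro j
  rw [PowerSeries.coeff_X]
  split_ifs with h
  · simp [h]
  · simpa using hr

/-- A polynomial has a finite Gauss norm. -/
lemma exists_gaussBound_polynomial (hr : 0 ≤ r) (p : C[X]) : ∃ B, GaussBound r B (p : C⟦X⟧) := by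
  refine ⟨∑ j ∈ Finset.range (p.natDegree + 1), ‖p.coeff j‖ * r ^ j, fun j => ?_⟩
  rw [Polynomial.coeff_coe]
  by_cases hj : j ∈ Finset.range (p.natDegree + 1)
  · exact Finset.single_le_sum (f := fun j => ‖p.coeff j‖ * r ^ j)
      (fun i _ => by positivity) hj
  · rw [Polynomial.coeff_eq_zero_of_natDegree_lt (by simpa using hj), norm_zero, zero_mul]
    exact Finset.sum_nonneg fun i _ => by positivity

variable [IsUltrametricDist C]

lemma GaussBound.add (hr : 0 ≤ r) (hf : GaussBound r B f) (hg : GaussBound r B g) :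
    GaussBound r B (f + g) := by
  intro j
  rw [map_add]
  calc _ ≤ max ‖PowerSeries.coeff j f‖ ‖PowerSeries.coeff j g‖ * r ^ j := by
        gcongr; exact IsUltrametricDist.norm_add_le_max _ _
    _ ≤ B := by
        rw [max_mul_of_nonneg _ _ (by positivity)]
        exact max_le (hf j) (hg j)

lemma GaussBound.sub (hr : 0 ≤ r) (hf : GaussBound r B f) (hg : GaussBound r B g) :
    GaussBound r B (f - g) := by
  rw [sub_eq_add_neg]
  exact hf.add hr hg.neg

lemma GaussBound.mul (hr : 0 ≤ r) (hf : GaussBound r A f) (hg : GaussBound r B g) :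
    GaussBound r (A * B) (f * g) := by
  intro j
  rw [← Real.norm_of_nonneg (r := r ^ j) (by positivity), PowerSeries.coeff_mul]
  -- The ultrametric estimate is made after dividing by `r ^ j`, so radius zero, where only constant
  -- coefficients count, is treated apart.
  rcases hr.eq_or_lt with rfl | hr
  · rcases j with _ | j
    · have h1 := hf 0
      have h2 := hg 0
      simp only [pow_zero, mul_one] at h1 h2
      simpa using mul_le_mul h1 h2 (norm_nonneg _) hf.nonneg
    · simpa using mul_nonneg hf.nonneg hg.nonneg
  · rw [Real.norm_of_nonneg (by positivity), ← le_div_iff₀ (by positivity)]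
    refine IsUltrametricDist.norm_sum_le_of_forall_le_of_nonneg
      (div_nonneg (mul_nonneg hf.nonneg hg.nonneg) (by positivity)) fun p hp => ?_
    rw [le_div_iff₀ (by positivity), norm_mul, ← Finset.HasAntidiagonal.mem_antidiagonal.mp hp,
      pow_add]
    calc _ = (‖PowerSeries.coeff p.1 f‖ * r ^ p.1) * (‖PowerSeries.coeff p.2 g‖ * r ^ p.2) := by
          ring
      _ ≤ A * B := mul_le_mul (hf _) (hg _) (by positivity) hf.nonneg

lemma norm_eval_le_of_gaussBound {p : C[X]} {a : C} (ha : ‖a‖ ≤ r)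
    (hp : GaussBound r B (p : C⟦X⟧)) : ‖p.eval a‖ ≤ B := by
  rw [Polynomial.eval_eq_sum_range]
  refine IsUltrametricDist.norm_sum_le_of_forall_le_of_nonneg hp.nonneg fun j _ => ?_
  rw [norm_mul, norm_pow]
  refine le_trans ?_ (hp j)
  rw [Polynomial.coeff_coe]
  gcongr

/-- Division by `X - a` divides the Gauss norm of radius `r ≥ |a|` by `r`. -/
lemma GaussBound.of_X_sub_C_mul {p : C[X]} {a : C} (hr : 0 < r) (ha : ‖a‖ ≤ r)
    (h : GaussBound r B (((X - Polynomial.C a) * p : C[X]) : C⟦X⟧)) :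
    GaussBound r (B / r) (p : C⟦X⟧) := by
  -- Downward induction on `j`, starting above the degree: `p_j` is the coefficient of index `j + 1`
  -- of `(X - a) p`, plus `a p_(j+1)`.
  have key : ∀ k j, p.natDegree < j + k → ‖p.coeff j‖ * r ^ (j + 1) ≤ B := by
    intro k
    induction k with
    | zero =>
      intro j hj
      rw [Polynomial.coeff_eq_zero_of_natDegree_lt (by omega), norm_zero, zero_mul]
      exact h.nonneg
    | succ k ih =>
      intro j hj
      have h1 := ih (j + 1) (by omega)
      have h2 := h (j + 1)
      rw [Polynomial.coeff_coe, sub_mul, Polynomial.coeff_sub, Polynomial.coeff_X_mul,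
        Polynomial.coeff_C_mul] at h2
      have h3 : ‖a * p.coeff (j + 1)‖ * r ^ (j + 1) ≤ B := by
        refine le_trans ?_ h1
        rw [norm_mul, pow_succ r (j + 1)]
        calc _ ≤ r * ‖p.coeff (j + 1)‖ * r ^ (j + 1) := by gcongr
          _ = _ := by ring
      calc _ = ‖(p.coeff j - a * p.coeff (j + 1)) + a * p.coeff (j + 1)‖ * r ^ (j + 1) := by
            rw [sub_add_cancel]
        _ ≤ max ‖p.coeff j - a * p.coeff (j + 1)‖ ‖a * p.coeff (j + 1)‖ * r ^ (j + 1) := by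
            gcongr; exact IsUltrametricDist.norm_add_le_max _ _
        _ ≤ B := by
            rw [max_mul_of_nonneg _ _ (by positivity)]
            exact max_le h2 h3
  intro j
  rw [Polynomial.coeff_coe, le_div_iff₀ hr, mul_assoc, ← pow_succ]
  exact key (p.natDegree + 1) j (by omega)

-- Every term except the one of index 0 contains `X - a_0`; what remains is a Newton sum with
-- shifted nodes and coefficients, which makes induction on the index possible.
omit [IsUltrametricDist C] in
lemma newton_sum_succ (a e : ℕ → C) (M : ℕ) :
    ∑ i ∈ Finset.range (M + 1), Polynomial.C (e i) *
      ∏ s ∈ Finset.range i, (X - Polynomial.C (a s)) =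
    (X - Polynomial.C (a 0)) * (∑ i ∈ Finset.range M, Polynomial.C (e (i + 1)) *
      ∏ s ∈ Finset.range i, (X - Polynomial.C (a (s + 1)))) + Polynomial.C (e 0) := by
  rw [Finset.sum_range_succ', Finset.mul_sum, Finset.prod_range_zero, mul_one]
  congr 1
  refine Finset.sum_congr rfl fun i _ => ?_
  rw [Finset.prod_range_succ', ← mul_assoc, mul_comm]

/-- Evaluation at `a` isolates `e`, and evaluation on the disc of radius `r` is bounded by the Gauss
norm. -/
lemma norm_le_of_gaussBound_X_sub_C_mul_add {p : C[X]} {a e : C} (ha : ‖a‖ ≤ r)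
    (h : GaussBound r B (((X - Polynomial.C a) * p + Polynomial.C e : C[X]) : C⟦X⟧)) :
    ‖e‖ ≤ B := by
  have := norm_eval_le_of_gaussBound ha h
  rwa [Polynomial.eval_add, Polynomial.eval_mul, Polynomial.eval_sub, Polynomial.eval_X,
    Polynomial.eval_C, sub_self, zero_mul, zero_add, Polynomial.eval_C] at this

/-- The coefficients of the Newton expansion of a polynomial with respect to nodes of absolute value
at most `r` are bounded by its Gauss norm of radius `r`. -/
lemma norm_newton_coeff_le (hr : 0 < r) {l M : ℕ} {a e : ℕ → C} (hM : l < M)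
    (ha : ∀ s ≤ l, ‖a s‖ ≤ r)
    (h : GaussBound r B ((∑ i ∈ Finset.range M, Polynomial.C (e i) *
      ∏ s ∈ Finset.range i, (X - Polynomial.C (a s)) : C[X]) : C⟦X⟧)) :
    ‖e l‖ * r ^ l ≤ B := by
  induction l generalizing M a e B with
  | zero =>
    obtain _ | M := M
    · omega
    rw [newton_sum_succ] at h
    rw [pow_zero, mul_one]
    exact norm_le_of_gaussBound_X_sub_C_mul_add (ha 0 le_rfl) h
  | succ l ih =>
    obtain _ | M := M
    · omega
    rw [newton_sum_succ] at h
    have h0 := norm_le_of_gaussBound_X_sub_C_mul_add (ha 0 (Nat.zero_le _)) h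
    rw [Polynomial.coe_add, Polynomial.coe_C] at h
    -- Removing `e 0` keeps the bound `B`, and dividing by `X - a 0` improves it to `B / r`; this
    -- supplies the extra power of `r`.
    have h1 := h.sub hr.le ((gaussBound_C (e 0)).mono h0)
    rw [add_sub_cancel_right] at h1
    have h2 := ih (M := M) (a := fun s => a (s + 1)) (e := fun i => e (i + 1)) (by omega)
      (fun s hs => ha (s + 1) (by omega)) (h1.of_X_sub_C_mul hr (ha 0 (Nat.zero_le _)))
    rwa [le_div_iff₀ hr, mul_assoc, ← pow_succ] at h2

end GaussBound

/-! ### Last rows of the logarithm coefficients -/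

section LogCoefficients
open Polynomial Matrix
variable (F : Type*) [Field F] [Fintype F] {C : Type*} [Field C] [Algebra F C] (n : ℕ) (θ : C)

lemma carlitzTensor_X : carlitzTensor F n θ X = carlitzT F n θ := by simp [carlitzTensor]

lemma lieAction_X : lieAction F n θ X = carlitzLie n θ := by
  rw [lieAction_apply, carlitzTensor_X, carlitzT, TwistedSeries.add_apply]
  simp [TwistedSeries.monomial]

/-- Only the coefficients of `τ^0` and `τ^1` of `C_t` contribute, and the corner matrix, having
entries 0 and 1, is fixed by Frobenius. -/
lemma mul_carlitzT_apply_succ (f : MatSeries F C n) (i : ℕ) :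
    (f * carlitzT F n θ) (i + 1) =
      f (i + 1) * carlitzLie n (θ ^ Fintype.card F ^ (i + 1)) + f i * carlitzCorner C n := by
  have hc : ((frob F C).mapMatrix ^ i) (carlitzCorner C n) = carlitzCorner C n := by
    rw [mapMatrix_pow]
    ext j k
    simp only [carlitzCorner, map_apply, of_apply]
    split_ifs <;> simp [frob_pow_apply]
  rw [carlitzT, mul_add, TwistedSeries.add_apply, TwistedSeries.mul_apply, TwistedSeries.mul_apply,
    Finset.sum_eq_single (i + 1, 0), Finset.sum_eq_single (i, 1)]
  · simp only [TwistedSeries.monomial, Pi.single_eq_same, hc, carlitzLie_map]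
  · rintro ⟨a, b⟩ h hne
    have : b ≠ 1 := by rintro rfl; simp at h; exact hne (by simp; omega)
    simp [TwistedSeries.monomial, this]
  · simp
  · rintro ⟨a, b⟩ h hne
    have : b ≠ 0 := by rintro rfl; simp at h; exact hne (by simp; omega)
    simp [TwistedSeries.monomial, this]
  · simp

variable (hθ : ∀ k, θ ^ Fintype.card F ^ (k + 1) ≠ θ)
include hθ

lemma carlitzLogSeries_zero : carlitzLogSeries F n θ 0 = 1 := by
  have h := congrFun (carlitzLogSeries_spec F n θ hθ).1 0
  rw [TwistedSeries.mul_apply, TwistedSeries.one_apply] at h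
  simpa [(isExp_carlitzExp F n θ hθ).1] using h

lemma carlitzLogSeries_succ (i : ℕ) :
    carlitzLogSeries F n θ (i + 1) * carlitzLie n (θ ^ Fintype.card F ^ (i + 1)) +
      carlitzLogSeries F n θ i * carlitzCorner C n =
    carlitzLie n θ * carlitzLogSeries F n θ (i + 1) := by
  have h := congrFun (carlitzLogSeries_mul F n θ hθ X) (i + 1)
  rwa [carlitzTensor_X, lieAction_X, mul_carlitzT_apply_succ,
    TwistedSeries.const_mul_apply] at h

/-- The last rows of the coefficients of the logarithm. -/
lemma carlitzLogSeries_last_row (i : ℕ) (k : Fin (n + 1)) :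
    carlitzLogSeries F (n + 1) θ (i + 1) (Fin.last n) k =
      carlitzLogSeries F (n + 1) θ i (Fin.last n) (Fin.last n) *
        (θ - θ ^ Fintype.card F ^ (i + 1))⁻¹ ^ ((k : ℕ) + 1) := by
  set L := carlitzLogSeries F (n + 1) θ
  have hb : θ - θ ^ Fintype.card F ^ (i + 1) ≠ 0 := sub_ne_zero.mpr (hθ i).symm
  have h := fun k => congrFun (congrFun (carlitzLogSeries_succ F (n + 1) θ hθ i) (Fin.last n)) k
  have hL : ∀ k, (carlitzLie (n + 1) θ * L (i + 1)) (Fin.last n) k =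
      θ * L (i + 1) (Fin.last n) k := by
    intro k
    rw [Matrix.mul_apply, Finset.sum_eq_single (Fin.last n)]
    · simp [carlitzLie]
    · intro j _ hj
      have := j.2
      simp [carlitzLie, hj.symm]
      omega
    · simp
  -- In column 0 the corner matrix feeds in the last entry of the previous last row; in later
  -- columns the superdiagonal feeds in the entry to the left. Each column costs one division by `θ
  -- - θ^(q^(i+1))`.
  induction k using Fin.induction with
  | zero =>
    have h0 := h 0
    rw [hL, Matrix.add_apply, Matrix.mul_apply, Matrix.mul_apply, Finset.sum_eq_single 0,
      Finset.sum_eq_single (Fin.last n)] at h0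
    · simp [carlitzLie, carlitzCorner] at h0
      simp only [Fin.val_zero, zero_add, pow_one]
      field_simp
      linear_combination -h0
    · intro j _ hj
      have : (j : ℕ) ≠ n := fun h => hj (Fin.ext h)
      simp [carlitzCorner, this]
    · simp
    · intro j _ hj
      simp [carlitzLie, hj]
    · simp
  | succ k ih =>
    have h0 := h k.succ
    rw [hL, Matrix.add_apply, Matrix.mul_apply, Matrix.mul_apply,
      Finset.sum_eq_add k.castSucc k.succ (by simp [Fin.ext_iff]), Finset.sum_eq_zero] at h0
    · simp [carlitzLie, Fin.ext_iff] at h0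
      rw [Fin.val_castSucc] at ih
      rw [Fin.val_succ, pow_succ, ← mul_assoc, ← ih, eq_mul_inv_iff_mul_eq₀ hb]
      linear_combination -h0
    · intro j _
      simp [carlitzCorner]
    · rintro j _ ⟨h1, h2⟩
      have h3 : (j : ℕ) ≠ k := fun h => h1 (Fin.ext h)
      simp [carlitzLie, h2, h3]
    · simp
    · simp

end LogCoefficients

/-! ### Telescoping of the partial sums -/

section Telescoping
open Polynomial

/-- The geometric sum in `x = (X - b)/(a - b)`, since `X - a = (a - b)(x - 1)`. -/
lemma sub_mul_sum_geom {C : Type*} [Field C] {a b : C} (hab : a ≠ b) (m : ℕ) :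
    (X - Polynomial.C a) * ∑ k ∈ Finset.range m,
      Polynomial.C ((a - b)⁻¹ ^ (k + 1)) * (X - Polynomial.C b) ^ k =
    Polynomial.C ((a - b)⁻¹ ^ m) * (X - Polynomial.C b) ^ m - 1 := by
  have h1 : (Polynomial.C a - Polynomial.C b) * Polynomial.C (a - b)⁻¹ = 1 := by
    rw [← Polynomial.C_sub, ← Polynomial.C_mul, mul_inv_cancel₀ (sub_ne_zero.mpr hab),
      Polynomial.C_1]
  induction m with
  | zero => simp
  | succ m ih =>
    rw [Finset.sum_range_succ, mul_add, ih]
    simp only [pow_succ, Polynomial.C_mul]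
    linear_combination -(Polynomial.C ((a - b)⁻¹ ^ m) * (X - Polynomial.C b) ^ m) * h1

variable (F : Type*) [Field F] [Fintype F] {C : Type*} [NormedField C] [Algebra F C]
  (n : ℕ) (θ : C)

/-- Frobenius moves each node `θ^(q^j)` to `θ^(q^(j+1))`, and the factor `(t - θ)^n` in `τ` refills
the node `j = 0`. -/
lemma motiveTau_iterate (i : ℕ) (k : Fin n) :
    (motiveTau F n θ)^[i] (motiveBasis n θ k) =
      (∏ j ∈ Finset.range i, (X - Polynomial.C (θ ^ Fintype.card F ^ j))) ^ n *
        (X - Polynomial.C (θ ^ Fintype.card F ^ i)) ^ (k : ℕ) := by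
  have hf : ∀ j, (frob F C) (θ ^ Fintype.card F ^ j) = θ ^ Fintype.card F ^ (j + 1) := by
    intro j
    simp [pow_succ, pow_mul]
  induction i with
  | zero => simp [motiveBasis]
  | succ i ih =>
    rw [Function.iterate_succ_apply', ih, motiveTau, Finset.prod_range_succ']
    simp only [Polynomial.map_mul, Polynomial.map_pow, Polynomial.map_prod, Polynomial.map_sub,
      Polynomial.map_X, Polynomial.map_C, hf]
    rw [pow_zero, pow_one, mul_pow, ← mul_assoc, mul_comm ((X - _) ^ n)]

/-- The product `∏_{1 ≤ j ≤ m} (t - θ^(q^j)) / (θ - θ^(q^j))`. -/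
def partialProduct (m : ℕ) : C[X] :=
  ∏ j ∈ Finset.range m, Polynomial.C (θ - θ ^ Fintype.card F ^ (j + 1))⁻¹ *
    (X - Polynomial.C (θ ^ Fintype.card F ^ (j + 1)))

/-- The partial sums of the expansion given by the last rows of the coefficients of the
logarithm. -/
lemma sum_carlitzLogSeries_last_row (hθ : ∀ k, θ ^ Fintype.card F ^ (k + 1) ≠ θ) (m : ℕ) :
    ∑ i ∈ Finset.range (m + 1), ∑ k : Fin (n + 1),
      Polynomial.C (carlitzLogSeries F (n + 1) θ i (Fin.last n) k) *
        (motiveTau F (n + 1) θ)^[i] (motiveBasis (n + 1) θ k) =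
    (X - Polynomial.C θ) ^ n * partialProduct F θ m ^ (n + 1) := by
  have hp : ∀ m, (X - Polynomial.C θ) * partialProduct F θ m *
      Polynomial.C (∏ j ∈ Finset.range m, (θ - θ ^ Fintype.card F ^ (j + 1))) =
      ∏ j ∈ Finset.range (m + 1), (X - Polynomial.C (θ ^ Fintype.card F ^ j)) := by
    intro m
    rw [Finset.prod_range_succ', partialProduct, Finset.prod_mul_distrib, ← map_prod,
      pow_zero, pow_one, mul_comm, mul_comm (X - _), ← mul_assoc, ← mul_assoc, ← Polynomial.C_mul,
      Finset.prod_inv_distrib, mul_inv_cancel₀, Polynomial.C_1, one_mul]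
    exact Finset.prod_ne_zero_iff.mpr fun j _ => sub_ne_zero.mpr (hθ j).symm
  have hlast : ∀ m, carlitzLogSeries F (n + 1) θ m (Fin.last n) (Fin.last n) *
      (∏ j ∈ Finset.range m, (θ - θ ^ Fintype.card F ^ (j + 1))) ^ (n + 1) = 1 := by
    intro m
    induction m with
    | zero => simp [carlitzLogSeries_zero F (n + 1) θ hθ]
    | succ m ih =>
      have hb : θ - θ ^ Fintype.card F ^ (m + 1) ≠ 0 := sub_ne_zero.mpr (hθ m).symm
      rw [carlitzLogSeries_last_row F n θ hθ, Finset.prod_range_succ, mul_pow, Fin.val_last,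
        mul_mul_mul_comm, ih, one_mul,
        ← mul_pow, inv_mul_cancel₀ hb, one_pow]
  have key : ∀ m, (X - Polynomial.C θ) ^ (n + 1) * partialProduct F θ m ^ (n + 1) =
      Polynomial.C (carlitzLogSeries F (n + 1) θ m (Fin.last n) (Fin.last n)) *
        (∏ j ∈ Finset.range (m + 1), (X - Polynomial.C (θ ^ Fintype.card F ^ j))) ^ (n + 1) := by
    intro m
    rw [← hp, mul_pow _ (Polynomial.C _), ← Polynomial.C_pow, mul_left_comm, ← Polynomial.C_mul,
      hlast, Polynomial.C_1, mul_one, mul_pow]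
  -- Multiplied by `X - θ`, the inner sum at each new index is geometric with `a = θ`, `b =
  -- θ^(q^(m+1))`; its term `-1` cancels the preceding partial sum.
  apply mul_left_cancel₀ (Polynomial.X_sub_C_ne_zero θ)
  rw [← mul_assoc, ← pow_succ']
  induction m with
  | zero =>
    -- As `P_0 = 1`, the index 0 contributes just the last basis vector `(X - θ)^n`. Hence `m + 1`
    -- summands match `m` factors.
    rw [Finset.sum_range_one, Finset.sum_eq_single (Fin.last n)]
    · simp [carlitzLogSeries_zero F (n + 1) θ hθ, motiveBasis, partialProduct, pow_succ']
    · intro k _ hk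
      simp [carlitzLogSeries_zero F (n + 1) θ hθ, hk.symm]
    · simp
  | succ m ih =>
    rw [Finset.sum_range_succ, mul_add, ih, key, key]
    have h := sub_mul_sum_geom (hθ m).symm (n + 1)
    rw [Finset.sum_range] at h
    have h2 : ∑ k : Fin (n + 1),
        Polynomial.C (carlitzLogSeries F (n + 1) θ (m + 1) (Fin.last n) k) *
          (motiveTau F (n + 1) θ)^[m + 1] (motiveBasis (n + 1) θ k) =
        Polynomial.C (carlitzLogSeries F (n + 1) θ m (Fin.last n) (Fin.last n)) *
        (∏ j ∈ Finset.range (m + 1), (X - Polynomial.C (θ ^ Fintype.card F ^ j))) ^ (n + 1) *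
        ∑ k : Fin (n + 1), Polynomial.C ((θ - θ ^ Fintype.card F ^ (m + 1))⁻¹ ^ ((k : ℕ) + 1)) *
          (X - Polynomial.C (θ ^ Fintype.card F ^ (m + 1))) ^ (k : ℕ) := by
      rw [Finset.mul_sum]
      refine Finset.sum_congr rfl fun k _ => ?_
      rw [motiveTau_iterate, carlitzLogSeries_last_row F n θ hθ, Polynomial.C_mul]
      ring
    rw [h2, mul_left_comm, h, carlitzLogSeries_last_row F n θ hθ, Fin.val_last,
      Finset.prod_range_succ _ (m + 1), mul_pow, Polynomial.C_mul]
    ring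

end Telescoping
-- Convergence in Gauss norms
section GaussTendsto
open Polynomial Filter Topology
open scoped PowerSeries PowerSeries.WithPiTopology
variable {C : Type*} [NormedField C] [IsUltrametricDist C] {r : ℝ} {f g : C⟦X⟧}

/-- Convergence of a sequence of power series in the Gauss norm of radius `r`. -/
def GaussTendsto (r : ℝ) (A : ℕ → C⟦X⟧) (f : C⟦X⟧) : Prop :=
  ∀ ε : ℝ, 0 < ε → ∀ᶠ m in atTop, GaussBound r ε (f - A m)

omit [IsUltrametricDist C] in
lemma gaussTendsto_const (f : C⟦X⟧) : GaussTendsto r (fun _ => f) f := by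
  intro ε hε
  refine Eventually.of_forall fun m j => ?_
  simpa using hε.le

lemma GaussTendsto.mul (hr : 0 ≤ r) {p q : ℕ → C[X]}
    (hf : GaussTendsto r (fun m => (p m : C⟦X⟧)) f)
    (hg : GaussTendsto r (fun m => (q m : C⟦X⟧)) g) :
    GaussTendsto r (fun m => ((p m * q m : C[X]) : C⟦X⟧)) (f * g) := by
  have bdd : ∀ {f : C⟦X⟧} {p : ℕ → C[X]}, GaussTendsto r (fun m => (p m : C⟦X⟧)) f →
      ∃ B, 0 < B ∧ GaussBound r B f := by
    intro f p hf
    obtain ⟨m, hm⟩ := (hf 1 one_pos).exists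
    obtain ⟨B, hB⟩ := exists_gaussBound_polynomial hr (p m)
    refine ⟨max 1 B, lt_max_of_lt_left one_pos, ?_⟩
    rw [← sub_add_cancel f (p m : C⟦X⟧)]
    exact (hm.mono (le_max_left _ _)).add hr (hB.mono (le_max_right _ _))
  obtain ⟨A, hA, hfA⟩ := bdd hf
  obtain ⟨B, hB, hgB⟩ := bdd hg
  intro ε hε
  -- The first condition keeps `p m` bounded by `A`; the other two make both terms of `(f - p)g +
  -- p(g - q)` at most `ε`.
  filter_upwards [hf A hA, hf (ε / B) (by positivity), hg (ε / A) (by positivity)]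
    with m h1 h2 h3
  have h4 : GaussBound r A (p m : C⟦X⟧) := by
    rw [← sub_sub_cancel f (p m : C⟦X⟧)]
    exact hfA.sub hr h1
  have h5 := h2.mul hr hgB
  have h6 := h4.mul hr h3
  rw [div_mul_cancel₀ _ hB.ne'] at h5
  rw [mul_div_cancel₀ _ hA.ne'] at h6
  have h7 : f * g - ((p m * q m : C[X]) : C⟦X⟧) =
      (f - p m) * g + p m * (g - q m) := by
    rw [Polynomial.coe_mul]
    ring
  rw [h7]
  exact h5.add hr h6

lemma GaussTendsto.pow (hr : 0 ≤ r) {p : ℕ → C[X]}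
    (hf : GaussTendsto r (fun m => (p m : C⟦X⟧)) f) (n : ℕ) :
    GaussTendsto r (fun m => ((p m ^ n : C[X]) : C⟦X⟧)) (f ^ n) := by
  induction n with
  | zero => simpa using gaussTendsto_const (1 : C⟦X⟧)
  | succ n ih =>
    simp only [pow_succ]
    exact ih.mul hr hf

/-- A sequence of power series whose successive differences tend to zero in all Gauss norms
converges. -/
lemma exists_gaussTendsto [CompleteSpace C] {A : ℕ → C⟦X⟧}
    (hA : ∀ r : ℝ, 0 < r → ∀ ε : ℝ, 0 < ε → ∀ᶠ m in atTop, GaussBound r ε (A (m + 1) - A m)) :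
    ∃ f, Tendsto A atTop (𝓝 f) ∧ ∀ r : ℝ, 0 < r → GaussTendsto r A f := by
  -- By the ultrametric inequality small successive differences already give a Cauchy sequence,
  -- without summability.
  have key : ∀ r : ℝ, 0 < r → ∀ ε : ℝ, 0 < ε →
      ∃ N, ∀ m ≥ N, ∀ M ≥ m, GaussBound r ε (A M - A m) := by
    intro r hr ε hε
    obtain ⟨N, hN⟩ := eventually_atTop.mp (hA r hr ε hε)
    refine ⟨N, fun m hm M hM => ?_⟩
    induction M, hM using Nat.le_induction with
    | base => intro j; simpa using hε.le
    | succ M hM ih =>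
      rw [← sub_add_sub_cancel _ (A M)]
      exact (hN M (hm.trans hM)).add hr.le ih
  have hlim : ∀ j, ∃ a, Tendsto (fun m => PowerSeries.coeff j (A m)) atTop (𝓝 a) := by
    intro j
    apply cauchySeq_tendsto_of_complete
    refine Metric.cauchySeq_iff'.mpr fun ε hε => ?_
    obtain ⟨N, hN⟩ := key 1 one_pos (ε / 2) (by positivity)
    refine ⟨N, fun M hM => ?_⟩
    have := hN N le_rfl M hM j
    rw [one_pow, mul_one, map_sub] at this
    rw [dist_eq_norm]
    linarith
  choose a ha using hlim
  refine ⟨PowerSeries.mk a, ?_, fun r hr ε hε => ?_⟩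
  · rw [PowerSeries.WithPiTopology.tendsto_iff_coeff_tendsto]
    simpa using ha
  · obtain ⟨N, hN⟩ := key r hr ε hε
    filter_upwards [eventually_ge_atTop N] with m hm j
    have h1 : Tendsto (fun M => ‖PowerSeries.coeff j (A M - A m)‖ * r ^ j) atTop
        (𝓝 (‖PowerSeries.coeff j (PowerSeries.mk a - A m)‖ * r ^ j)) := by
      simp only [map_sub, PowerSeries.coeff_mk]
      exact ((ha j).sub_const _).norm.mul_const _
    refine le_of_tendsto h1 ?_
    filter_upwards [eventually_ge_atTop m] with M hM using hN m hm M hM j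

/-- A product of polynomials `u_j` converges to an entire function if `u_j - 1` tends to zero in all
Gauss norms. -/
lemma exists_gaussTendsto_prod [CompleteSpace C] {u : ℕ → C[X]}
    (hu : ∀ r : ℝ, 0 < r → ∀ ε : ℝ, 0 < ε →
      ∀ᶠ m in atTop, GaussBound r ε ((u m - 1 : C[X]) : C⟦X⟧)) :
    ∃ f, Tendsto (fun m => ((∏ j ∈ Finset.range m, u j : C[X]) : C⟦X⟧)) atTop (𝓝 f) ∧
      ∀ r : ℝ, 0 < r →
        GaussTendsto r (fun m => ((∏ j ∈ Finset.range m, u j : C[X]) : C⟦X⟧)) f := by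
  apply exists_gaussTendsto
  intro r hr ε hε
  obtain ⟨N, hN⟩ := eventually_atTop.mp (hu r hr 1 one_pos)
  obtain ⟨B, hB⟩ := exists_gaussBound_polynomial hr.le (∏ j ∈ Finset.range N, u j)
  have step : ∀ m, ((∏ j ∈ Finset.range (m + 1), u j : C[X]) : C⟦X⟧) -
      ((∏ j ∈ Finset.range m, u j : C[X]) : C⟦X⟧) =
      ((∏ j ∈ Finset.range m, u j : C[X]) : C⟦X⟧) * ((u m - 1 : C[X]) : C⟦X⟧) := by
    intro m
    rw [Finset.prod_range_succ, ← Polynomial.coe_sub, ← Polynomial.coe_mul, mul_sub, mul_one]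
  -- From `N` on, `u m - 1` has norm at most 1, so a further factor does not enlarge the bound.
  have bdd : ∀ m ≥ N, GaussBound r B ((∏ j ∈ Finset.range m, u j : C[X]) : C⟦X⟧) := by
    intro m hm
    induction m, hm using Nat.le_induction with
    | base => exact hB
    | succ m hm ih =>
      rw [← sub_add_cancel ((∏ j ∈ Finset.range (m + 1), u j : C[X]) : C⟦X⟧)
        ((∏ j ∈ Finset.range m, u j : C[X]) : C⟦X⟧), step]
      have := ih.mul hr.le (hN m hm)
      rw [mul_one] at this
      exact this.add hr.le ih
  have hB0 := hB.nonneg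
  -- `B + 1` replaces `B`, which might be zero.
  filter_upwards [eventually_ge_atTop N, hu r hr (ε / (B + 1)) (by positivity)] with m hm h
  rw [step]
  refine ((bdd m hm).mul hr.le h).mono ?_
  rw [mul_div_assoc', div_le_iff₀ (by positivity)]
  nlinarith

end GaussTendsto

/-! ### Uniqueness of `τ`-expansions -/

section Uniqueness
open Polynomial Filter Topology
open scoped PowerSeries
variable (F : Type*) [Field F] [Fintype F] {C : Type*} [NormedField C] [Algebra F C]
  {n : ℕ} (θ : C)

/-- An expansion in the `τ^i(g_k)` is a Newton expansion in which each node `θ^(q^i)` is repeated `n`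
times. -/
lemma sum_motiveTau_eq_newton_sum (hn : 0 < n) (c : ℕ → Fin n → C) (m : ℕ) :
    ∑ i ∈ Finset.range m, ∑ k : Fin n,
      Polynomial.C (c i k) * (motiveTau F n θ)^[i] (motiveBasis n θ k) =
    ∑ l ∈ Finset.range (n * m), Polynomial.C (c (l / n) ⟨l % n, Nat.mod_lt _ hn⟩) *
      ∏ s ∈ Finset.range l, (X - Polynomial.C (θ ^ Fintype.card F ^ (s / n))) := by
  have hdiv : ∀ m k, k < n → (n * m + k) / n = m := by
    intro m k hk
    rw [Nat.mul_add_div hn, Nat.div_eq_of_lt hk, add_zero]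
  have hprod : ∀ m k, k ≤ n → ∏ s ∈ Finset.range (n * m + k),
      (X - Polynomial.C (θ ^ Fintype.card F ^ (s / n))) =
      (∏ s ∈ Finset.range (n * m), (X - Polynomial.C (θ ^ Fintype.card F ^ (s / n)))) *
        (X - Polynomial.C (θ ^ Fintype.card F ^ m)) ^ k := by
    intro m k hk
    rw [Finset.prod_range_add]
    congr 1
    rw [← Finset.card_range k, ← Finset.prod_const, Finset.card_range]
    refine Finset.prod_congr rfl fun s hs => ?_
    rw [hdiv m s ((Finset.mem_range.mp hs).trans_le hk)]
  have hprod' : ∀ m, ∏ s ∈ Finset.range (n * m),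
      (X - Polynomial.C (θ ^ Fintype.card F ^ (s / n))) =
      (∏ j ∈ Finset.range m, (X - Polynomial.C (θ ^ Fintype.card F ^ j))) ^ n := by
    intro m
    induction m with
    | zero => simp
    | succ m ih => rw [Nat.mul_succ, hprod m n le_rfl, ih, Finset.prod_range_succ, mul_pow]
  induction m with
  | zero => simp
  | succ m ih =>
    rw [Finset.sum_range_succ, ih, Nat.mul_succ, Finset.sum_range_add]
    congr 1
    rw [Finset.sum_range]
    refine Finset.sum_congr rfl fun k _ => ?_
    rw [motiveTau_iterate, hprod m k k.2.le, hprod']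
    have h1 : (n * m + k) % n = k := by rw [Nat.mul_add_mod, Nat.mod_eq_of_lt k.2]
    simp only [hdiv m k k.2, h1]

variable {F θ}

/-- The coefficients of a `τ`-expansion are determined by its sum. -/
lemma IsTauExpansion.unique [IsUltrametricDist C] (hn : 0 < n) (hθ : 1 < ‖θ‖) {f : C⟦X⟧}
    {c d : ℕ → Fin n → C} (hc : IsTauExpansion F n θ f c) (hd : IsTauExpansion F n θ f d) :
    c = d := by
  funext i k
  rw [← sub_eq_zero, ← norm_le_zero_iff]
  refine le_of_forall_gt_imp_ge_of_dense fun ε hε => ?_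
  -- This is the largest absolute value among the nodes up to Newton index `n * i + k`; it is at
  -- least 1, so the power of `r` in the coefficient bound can be dropped.
  set r : ℝ := ‖θ‖ ^ Fintype.card F ^ i
  have hr1 : 1 ≤ r := one_le_pow₀ hθ.le
  have hr : 0 < r := one_pos.trans_le hr1
  obtain ⟨m, h1, h2, h3⟩ :=
    ((hc r hr ε hε).and ((hd r hr ε hε).and (eventually_gt_atTop i))).exists
  have h4 := GaussBound.sub hr.le h2 h1
  rw [sub_sub_sub_cancel_left, ← Polynomial.coe_sub, ← Finset.sum_sub_distrib] at h4
  simp only [← Finset.sum_sub_distrib, ← sub_mul, ← Polynomial.C_sub] at h4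
  have h5 := sum_motiveTau_eq_newton_sum F θ hn (fun i k => c i k - d i k) m
  rw [h5] at h4
  have hl : (n * i + k) / n = i := by
    rw [Nat.mul_add_div hn, Nat.div_eq_of_lt k.2, add_zero]
  have hm : (n * i + k) % n = k := by rw [Nat.mul_add_mod, Nat.mod_eq_of_lt k.2]
  have h6 := norm_newton_coeff_le (l := n * i + k) hr
    (by have := Nat.mul_le_mul_left n (Nat.succ_le_of_lt h3)
        rw [Nat.mul_succ] at this
        have := k.2
        omega)
    (fun s hs => ?_) h4
  · simp only [hl, hm] at h6
    exact (le_mul_of_one_le_right (norm_nonneg _) (one_le_pow₀ hr1)).trans h6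
  · rw [norm_pow]
    refine pow_le_pow_right₀ hθ.le (Nat.pow_le_pow_right Fintype.card_pos ?_)
    rw [← hl]
    exact Nat.div_le_div_right hs

end Uniqueness

/-! ### The infinite product and the period -/

section Period
open Polynomial Filter Topology
open scoped PowerSeries PowerSeries.WithPiTopology
variable (F : Type*) [Field F] [Fintype F] {C : Type*} [NormedField C] {θ lam : C}

lemma one_sub_C_mul_X_mul_inv (a : C) :
    (1 - PowerSeries.C a * PowerSeries.X : C⟦X⟧) * (1 - PowerSeries.C a * PowerSeries.X)⁻¹ = 1 :=
  PowerSeries.mul_inv_cancel _ (by simp)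

lemma X_sub_C_eq_mul {a : C} (ha : a ≠ 0) : (PowerSeries.X - PowerSeries.C a : C⟦X⟧) =
    PowerSeries.C (-a) * (1 - PowerSeries.C a⁻¹ * PowerSeries.X) := by
  have h : (PowerSeries.C a * PowerSeries.C a⁻¹ : C⟦X⟧) = 1 := by
    rw [← map_mul, mul_inv_cancel₀ ha, map_one]
  rw [map_neg]
  linear_combination -PowerSeries.X * h

/-- Each `t - b` with `b = θ^(q^j)` cancels against the matching factor of `ω` up to `-b`, and
`-b/(θ - b) = (1 - θ^(1-q^j))⁻¹`. The factor of `ω` at `j = 0` is used up by `t - θ`, leaving `-θ λ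
= λ^q`; hence `m + 1` factors of `ω`. -/
lemma partialProduct_mul (hθ : 1 < ‖θ‖) (hlam : lam ^ (Fintype.card F - 1) = -θ) (m : ℕ) :
    (partialProduct F θ m : C⟦X⟧) *
      (PowerSeries.C lam * ∏ i ∈ Finset.range (m + 1),
        (1 - PowerSeries.C (θ ^ Fintype.card F ^ i)⁻¹ * PowerSeries.X)⁻¹) *
      (PowerSeries.X - PowerSeries.C θ) =
    PowerSeries.C (lam ^ Fintype.card F *
      ∏ i ∈ Finset.range m, (1 - θ ^ (1 - (Fintype.card F : ℤ) ^ (i + 1)))⁻¹) := by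
  have h0 : θ ≠ 0 := by rintro rfl; simp at hθ; linarith
  induction m with
  | zero =>
    have h1 := one_sub_C_mul_X_mul_inv θ⁻¹
    have h2 : lam ^ Fintype.card F = -θ * lam := by
      rw [← hlam, ← pow_succ, Nat.sub_add_cancel Fintype.card_pos]
    rw [X_sub_C_eq_mul h0]
    simp only [partialProduct, Finset.prod_range_zero, Polynomial.coe_one, zero_add,
      Finset.prod_range_one, pow_zero, pow_one, one_mul, mul_one, h2, map_mul]
    linear_combination PowerSeries.C lam * PowerSeries.C (-θ) * h1
  | succ m ih =>
    set b := θ ^ Fintype.card F ^ (m + 1)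
    have hb : b ≠ 0 := pow_ne_zero _ h0
    have hne : θ - b ≠ 0 := sub_ne_zero.mpr (pow_ne_of_one_lt_norm F hθ m).symm
    have h1 := one_sub_C_mul_X_mul_inv b⁻¹
    have h2 : (1 - θ ^ (1 - (Fintype.card F : ℤ) ^ (m + 1)))⁻¹ = (θ - b)⁻¹ * -b := by
      have : θ ^ (1 - (Fintype.card F : ℤ) ^ (m + 1)) = θ / b := by
        rw [zpow_sub₀ h0, zpow_one]
        norm_cast
      rw [this, ← div_eq_inv_mul, one_sub_div hb, inv_div, ← neg_sub b θ, neg_div_neg_eq]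
    have h3 : partialProduct F θ (m + 1) = partialProduct F θ m *
        (Polynomial.C (θ - b)⁻¹ * (X - Polynomial.C b)) := Finset.prod_range_succ _ _
    rw [h3, Finset.prod_range_succ _ (m + 1),
      Finset.prod_range_succ (fun i => (1 - θ ^ (1 - (Fintype.card F : ℤ) ^ (i + 1)))⁻¹) m,
      ← mul_assoc (lam ^ _),
      map_mul _ (_ * _), ← ih, h2, Polynomial.coe_mul, Polynomial.coe_mul, Polynomial.coe_C,
      Polynomial.coe_sub, Polynomial.coe_X, Polynomial.coe_C, X_sub_C_eq_mul hb,
      map_mul _ _ (-b)]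
    linear_combination (partialProduct F θ m : C⟦X⟧) *
      (PowerSeries.C lam * ∏ i ∈ Finset.range (m + 1),
        (1 - PowerSeries.C (θ ^ Fintype.card F ^ i)⁻¹ * PowerSeries.X)⁻¹) *
      (PowerSeries.X - PowerSeries.C θ) * PowerSeries.C (θ - b)⁻¹ * PowerSeries.C (-b) * h1

variable [IsUltrametricDist C]

/-- The difference equals `(t - θ)/(θ - θ^(q^(m+1)))`: a fixed numerator over a constant of absolute
value `|θ|^(q^(m+1))`. -/
lemma eventually_gaussBound_factor_sub_one (hθ : 1 < ‖θ‖) {r ε : ℝ} (hr : 0 < r) (hε : 0 < ε) :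
    ∀ᶠ m in atTop, GaussBound r ε ((Polynomial.C (θ - θ ^ Fintype.card F ^ (m + 1))⁻¹ *
      (X - Polynomial.C (θ ^ Fintype.card F ^ (m + 1))) - 1 : C[X]) : C⟦X⟧) := by
  have h1 : ∀ m, Polynomial.C (θ - θ ^ Fintype.card F ^ (m + 1))⁻¹ *
      (X - Polynomial.C (θ ^ Fintype.card F ^ (m + 1))) - 1 =
      Polynomial.C (θ - θ ^ Fintype.card F ^ (m + 1))⁻¹ * (X - Polynomial.C θ) := by
    intro m
    have hne := sub_ne_zero.mpr (pow_ne_of_one_lt_norm F hθ m).symm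
    have : Polynomial.C (θ - θ ^ Fintype.card F ^ (m + 1))⁻¹ *
        (Polynomial.C θ - Polynomial.C (θ ^ Fintype.card F ^ (m + 1))) = 1 := by
      rw [← Polynomial.C_sub, ← Polynomial.C_mul, inv_mul_cancel₀ hne, Polynomial.C_1]
    linear_combination this
  have h2 : ∀ m, ‖(θ - θ ^ Fintype.card F ^ (m + 1))⁻¹‖ =
      ‖(θ ^ Fintype.card F ^ (m + 1))⁻¹‖ := by
    intro m
    have hlt : ‖θ‖ < ‖θ ^ Fintype.card F ^ (m + 1)‖ := by
      rw [norm_pow]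
      exact lt_self_pow₀ hθ (Nat.one_lt_pow (by omega) Fintype.one_lt_card)
    rw [norm_inv, norm_inv, sub_eq_add_neg, IsUltrametricDist.norm_add_eq_max_of_norm_ne_norm
      (by rw [norm_neg]; exact hlt.ne), norm_neg, max_eq_right hlt.le]
  set R := max r ‖θ‖
  have hR : 0 < R := lt_max_of_lt_left hr
  have h3 : GaussBound r R (PowerSeries.X - PowerSeries.C θ : C⟦X⟧) :=
    ((gaussBound_X hr.le).mono (le_max_left _ _)).sub hr.le
      ((gaussBound_C θ).mono (le_max_right _ _))
  have h4 := (summable_inv F hθ).tendsto_atTop_zero.comp (tendsto_add_atTop_nat 1)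
  filter_upwards [h4.eventually_lt_const (show 0 < ε / R by positivity)] with m hm
  rw [h1, Polynomial.coe_mul, Polynomial.coe_sub, Polynomial.coe_X, Polynomial.coe_C,
    Polynomial.coe_C]
  refine ((gaussBound_C _).mul hr.le h3).mono ?_
  rw [h2, ← le_div_iff₀ hR]
  exact hm.le

/-- The products `∏_{1 ≤ j ≤ m} (t - θ^(q^j)) / (θ - θ^(q^j))` converge to the entire function
`π / ((t - θ) ω)`. -/
lemma exists_gaussTendsto_partialProduct [CompleteSpace C] (hθ : 1 < ‖θ‖)
    (hlam : lam ^ (Fintype.card F - 1) = -θ) :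
    ∃ P : C⟦X⟧, P * andersonThakur F θ lam * (PowerSeries.X - PowerSeries.C θ) =
      PowerSeries.C (carlitzPeriod F θ lam) ∧
      ∀ r : ℝ, 0 < r → GaussTendsto r (fun m => (partialProduct F θ m : C⟦X⟧)) P := by
  obtain ⟨P, hP, hP'⟩ := exists_gaussTendsto_prod (C := C) fun r hr ε hε =>
    eventually_gaussBound_factor_sub_one F hθ hr hε
  refine ⟨P, ?_, hP'⟩
  -- The identity `partialProduct_mul` passes to the limit coefficientwise; the shift accounts for
  -- the extra factor of `ω`.
  have h1 := (multipliable_andersonThakur F hθ).hasProd.tendsto_prod_nat.comp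
    (tendsto_add_atTop_nat 1)
  have h2 := (multipliable_carlitzPeriod F hθ).hasProd.tendsto_prod_nat
  have h3 := (hP.mul (h1.const_mul (PowerSeries.C lam))).mul_const
    (PowerSeries.X - PowerSeries.C θ)
  have h4 := ((PowerSeries.WithPiTopology.continuous_C (R := C)).tendsto _).comp
    (h2.const_mul (lam ^ Fintype.card F))
  refine tendsto_nhds_unique h3 (h4.congr fun m => ?_)
  exact (partialProduct_mul F hθ hlam m).symm

lemma constantCoeff_andersonThakur [CompleteSpace C] (hθ : 1 < ‖θ‖) :
    PowerSeries.constantCoeff (andersonThakur F θ lam) = lam := by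
  have h := ((PowerSeries.WithPiTopology.continuous_constantCoeff C).tendsto _).comp
    (multipliable_andersonThakur F hθ).hasProd.tendsto_prod_nat
  have h1 := tendsto_nhds_unique h (tendsto_const_nhds.congr fun m => by
    rw [Function.comp_apply, map_prod, Finset.prod_eq_one]
    intro i _
    rw [PowerSeries.constantCoeff_inv]
    simp)
  rw [andersonThakur, map_mul, h1, PowerSeries.constantCoeff_C, mul_one]

/-- The power series inverse is a genuine one because the constant coefficient `-θ λ^(n+1)` is
nonzero. Raising `hP` to the power `n + 1` gives `n + 1` factors `t - θ`, one of which cancels. -/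
lemma period_pow_mul_inv [CompleteSpace C] (n : ℕ) {P : C⟦X⟧} (hθ : 1 < ‖θ‖)
    (hlam : lam ^ (Fintype.card F - 1) = -θ)
    (hP : P * andersonThakur F θ lam * (PowerSeries.X - PowerSeries.C θ) =
      PowerSeries.C (carlitzPeriod F θ lam)) :
    PowerSeries.C (carlitzPeriod F θ lam ^ (n + 1)) *
      ((PowerSeries.X - PowerSeries.C θ) * andersonThakur F θ lam ^ (n + 1))⁻¹ =
    (PowerSeries.X - PowerSeries.C θ) ^ n * P ^ (n + 1) := by
  have h0 : θ ≠ 0 := by rintro rfl; simp at hθ; linarith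
  have hl : lam ≠ 0 := by
    rintro rfl
    rw [zero_pow (Nat.sub_pos_of_lt Fintype.one_lt_card).ne', eq_comm, neg_eq_zero] at hlam
    exact h0 hlam
  symm
  rw [PowerSeries.eq_mul_inv_iff_mul_eq, map_pow, ← hP, mul_pow, mul_pow, pow_succ _ n,
    pow_succ (PowerSeries.X - PowerSeries.C θ) n]
  · ring
  · rw [map_mul, map_pow, constantCoeff_andersonThakur F hθ]
    simp [h0, hl]

end Period

/-! ### The logarithm as a value of `δ_{1,z}` -/

section Main
open Polynomial Filter Topology
open scoped PowerSeries PowerSeries.WithPiTopology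
variable (F : Type*) [Field F] [Fintype F] {C : Type*} [NormedField C] [Algebra F C]
  [IsUltrametricDist C] [CompleteSpace C] (n : ℕ) {θ lam : C}

lemma isTauExpansion_carlitzLogSeries (hθ : 1 < ‖θ‖)
    (hlam : lam ^ (Fintype.card F - 1) = -θ) :
    IsTauExpansion F (n + 1) θ
      (PowerSeries.C (carlitzPeriod F θ lam ^ (n + 1)) *
        ((PowerSeries.X - PowerSeries.C θ) * andersonThakur F θ lam ^ (n + 1))⁻¹)
      fun i => carlitzLogSeries F (n + 1) θ i (Fin.last n) := by
  obtain ⟨P, hP, hP'⟩ := exists_gaussTendsto_partialProduct F hθ hlam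
  rw [period_pow_mul_inv F n hθ hlam hP]
  intro r hr ε hε
  have h1 : GaussTendsto r (fun _ => (((X - Polynomial.C θ) ^ n : C[X]) : C⟦X⟧))
      ((PowerSeries.X - PowerSeries.C θ) ^ n) := by
    convert gaussTendsto_const (((X - Polynomial.C θ) ^ n : C[X]) : C⟦X⟧)
    simp
  obtain ⟨N, hN⟩ := eventually_atTop.mp (h1.mul hr.le ((hP' r hr).pow hr.le (n + 1)) ε hε)
  refine eventually_atTop.mpr ⟨N + 1, fun m hm => ?_⟩
  obtain _ | m := m
  · omega
  rw [sum_carlitzLogSeries_last_row F n θ (pow_ne_of_one_lt_norm F hθ)]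
  exact hN m (by omega)

theorem hasDeltaOne_iff_eq_carlitzLog (hθ : 1 < ‖θ‖)
    (hlam : lam ^ (Fintype.card F - 1) = -θ) {z : Fin (n + 1) → C}
    (hz : z ∈ logDomain F (n + 1) θ) (v : C) :
    HasDeltaOne F (n + 1) θ z
      (PowerSeries.C (carlitzPeriod F θ lam ^ (n + 1)) *
        ((PowerSeries.X - PowerSeries.C θ) * andersonThakur F θ lam ^ (n + 1))⁻¹) v ↔
    v = carlitzLog F (n + 1) θ z (Fin.last n) := by
  have hc := isTauExpansion_carlitzLogSeries F n hθ hlam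
  have hs : HasSum (fun i => ∑ k, carlitzLogSeries F (n + 1) θ i (Fin.last n) k *
      z k ^ Fintype.card F ^ i) (carlitzLog F (n + 1) θ z (Fin.last n)) :=
    -- Summation in `C^(n+1)` is coordinatewise, and the last coordinate of `P_i z^{(i)}` pairs the
    -- last row of `P_i` with `z^{(i)}`.
    Pi.hasSum.mp (show Summable (logTerm F (n + 1) θ z) from hz).hasSum (Fin.last n)
  constructor
  · rintro ⟨d, hd, hv⟩
    rw [hd.unique (Nat.succ_pos n) hθ hc] at hv
    exact hv.unique hs
  · rintro rfl
    exact ⟨_, hc, hs⟩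

end Main
end
end CarlitzTensor

/-- The equivalence for every `v` contains both that `δ_{1,z}` is defined there and that its value
is unique. -/
theorem mainTheorem8 (F : Type*) [Field F] [Fintype F] (n : ℕ) (hn : 0 < n)
    (lam : CarlitzTensor.CInfty F)
    (hlam : lam ^ (Fintype.card F - 1) = -CarlitzTensor.CInfty.theta F)
    (z : Fin n → CarlitzTensor.CInfty F)
    (hz : z ∈ CarlitzTensor.logDomain F n (CarlitzTensor.CInfty.theta F)) :
    ∀ v : CarlitzTensor.CInfty F,
      CarlitzTensor.HasDeltaOne F n (CarlitzTensor.CInfty.theta F) z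
        (PowerSeries.C (CarlitzTensor.carlitzPeriod F (CarlitzTensor.CInfty.theta F) lam ^ n) *
          ((PowerSeries.X - PowerSeries.C (CarlitzTensor.CInfty.theta F)) *
            CarlitzTensor.andersonThakur F (CarlitzTensor.CInfty.theta F) lam ^ n)⁻¹) v ↔
      v = CarlitzTensor.carlitzLog F n (CarlitzTensor.CInfty.theta F) z ⟨n - 1, by omega⟩ := by
  obtain _ | n := n
  · omega
  exact CarlitzTensor.hasDeltaOne_iff_eq_carlitzLog F n (CarlitzTensor.CInfty.one_lt_norm_theta F)
    hlam hz
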